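/- Let $A$ and $B$ be qudits (finite-dimensional systems) and let $U_A,U_B$ be operators on them with $U_A^2=U_A^\dagger U_A=I$ and $U_B^2=U_B^\dagger U_B=I$. A state $\rho_{AB}$ is called odd (even) if it is supported on the eigenspace of $U_A\otimes U_B$ with eigenvalue $-1$ ($+1$). Consider the following protocols with $N$ rounds. 1. Preparation: in round $m$ Alice and Bob share a state $\sigma_{AB}^{(m)}$ and hold qubits $A',B'$ in the state $|{+i}\rangle=(|0\rangle+i|1\rangle)/\sqrt2$. Alice applies $C_{A'A}(U)=|0\rangle\langle 0|_{A'}\otimes I_A+|1\rangle\langle 1|_{A'}\otimes U_A$ and Bob applies $C_{B'B}(U)=|0\rangle\langle 0|_{B'}\otimes I_B+|1\rangle\langle 1|_{B'}\otimes U_B$. 2. Attack: $A$ and $B$ are sent to Eve, who holds a finite-dimensional system $E$. She applies an arbitrary quantum instrument, jointly on the systems $A,B$ of all rounds and on $E$, keeps the quantum output, and announces the classical outcome $c=(c_1,\dots,c_N)$, with symbols $c_m$ from a finite alphabet. 3. Depending on $c$, Bob applies the Pauli operator $Y$ to $B'$ in some of the rounds, and some of the rounds are kept; the qubits of the other rounds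 are discarded. Let $n$ be the number of kept rounds. 4. Key generation. Protocol I: Alice and Bob measure $A'$ and $B'$ of each kept round in the $Z$ basis. Protocol Ia: in each kept round they first apply $|0\rangle\langle 0|_{A'}\otimes I_{B'}+|1\rangle\langle 1|_{A'}\otimes(-Z_{B'})$; then Bob measures $B'$ in the $X$ basis and Alice measures $A'$ in the $Z$ basis. In both protocols the key $\kappa_{rec}\in\{0,1\}^n$ is the string of Alice's $Z$-basis outcomes. Bob's outcomes are not revealed to Eve. Theorem. Suppose that each $\sigma_{AB}^{(m)}$ is a mixture (convex combination) of odd and even states, and that Eve is initially decoupled, that is, the initial joint state of the qudits of all rounds and of Eve's system is $\rho_{ABE}=\bigl(\bigotimes_{m=1}^N\sigma_{AB}^{(m)}\bigr)\otimes\rho_E$ for a density operator $\rho_E$. Then, in Protocol I and in Protocol Ia, for every instrument of Eve, every choice of the functions of $c$ that determine the rounds with a $Y$ and the kept rounds, and every announcement $c$ of nonzero probability, Eve has no information on $\kappa_{rec}$: the joint state of $\kappa_{rec}$ and of Eve's final system, conditioned on $c$, is $$\frac1{2^n}\sum_{s\in\{0,1\}^n}|s\rangle\langle s|\otimes\rho'_E$$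 for some density operator $\rho'_E$ that does not depend on $s$. In particular the key is $\epsilon$-secret with $\epsilon=0$, where $\epsilon$-secret means that the joint state of key and Eve has distance $\frac12\|\cdot\|_1$ at most $\epsilon$ from a state of the displayed form. -/

import Mathlib

open scoped Kronecker Matrix ComplexOrder

noncomputable section

namespace SymQKD

/-! All systems are finite-dimensional; a system is given by the finite type that labels its
computational basis, and operators are complex matrices. One round of the protocol uses the
qubits `A'`, `B'` (basis `Fin 2 × Fin 2`) and the qudits `A`, `B` (basis `a × b`). -/

/-- Density operators. -/
def IsState {r : Type*} [Fintype r] (ρ : Matrix r r ℂ) : Prop :=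
  ρ.PosSemidef ∧ ρ.trace = 1

/-- Conjugation `G ρ G†`. -/
def conj {r s : Type*} [Fintype r] (G : Matrix s r ℂ) (ρ : Matrix r r ℂ) : Matrix s s ℂ :=
  G * ρ * Gᴴ

/-- The tensor product of one operator per round. -/
def tensorRounds {R r : Type*} [Fintype R] (M : R → Matrix r r ℂ) :
    Matrix (R → r) (R → r) ℂ :=
  Matrix.of fun x y => ∏ m, M m (x m) (y m)

/-- The partial trace over the first tensor factor. -/
def traceLeft {r s : Type*} [Fintype r] (ρ : Matrix (r × s) (r × s) ℂ) : Matrix s s ℂ :=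
  Matrix.of fun i j => ∑ x, ρ (x, i) (x, j)

/-! ### Parity states -/

section Parity

variable {a b : Type*} [Fintype a] [Fintype b] [DecidableEq a] [DecidableEq b]

/-- The eigenspace of `U_A ⊗ U_B` for the eigenvalue `-1`. -/
def oddSpace (UA : Matrix a a ℂ) (UB : Matrix b b ℂ) : Submodule ℂ (a × b → ℂ) :=
  Module.End.eigenspace (Matrix.toLin' (UA ⊗ₖ UB)) (-1)

/-- The eigenspace of `U_A ⊗ U_B` for the eigenvalue `1`. -/
def evenSpace (UA : Matrix a a ℂ) (UB : Matrix b b ℂ) : Submodule ℂ (a × b → ℂ) :=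
  Module.End.eigenspace (Matrix.toLin' (UA ⊗ₖ UB)) 1

/-- A state supported on the odd space. -/
def IsOddState (UA : Matrix a a ℂ) (UB : Matrix b b ℂ) (ρ : Matrix (a × b) (a × b) ℂ) : Prop :=
  IsState ρ ∧ LinearMap.range (Matrix.toLin' ρ) ≤ oddSpace UA UB

/-- A state supported on the even space. -/
def IsEvenState (UA : Matrix a a ℂ) (UB : Matrix b b ℂ) (ρ : Matrix (a × b) (a × b) ℂ) : Prop :=
  IsState ρ ∧ LinearMap.range (Matrix.toLin' ρ) ≤ evenSpace UA UB

/-- A mixture (convex combination) of odd and even states. -/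
def IsParityMixture (UA : Matrix a a ℂ) (UB : Matrix b b ℂ)
    (σ : Matrix (a × b) (a × b) ℂ) : Prop :=
  σ ∈ convexHull ℝ {ρ | IsOddState UA UB ρ ∨ IsEvenState UA UB ρ}

end Parity

/-! ### Qubit states, gates and measurements -/

/-- `|s⟩⟨s|`, the `Z`-basis projectors. -/
def zProj (s : Fin 2) : Matrix (Fin 2) (Fin 2) ℂ := Matrix.single s s 1

/-- `|+⟩⟨+|` (for `s = 0`) and `|-⟩⟨-|` (for `s = 1`), the `X`-basis projectors. -/
def xProj (s : Fin 2) : Matrix (Fin 2) (Fin 2) ℂ :=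
  (1 / 2 : ℂ) • !![1, (-1) ^ (s : ℕ); (-1) ^ (s : ℕ), 1]

def pauliY : Matrix (Fin 2) (Fin 2) ℂ := !![0, -Complex.I; Complex.I, 0]

def pauliZ : Matrix (Fin 2) (Fin 2) ℂ := !![1, 0; 0, -1]

/-- The vector `|+i⟩ = (|0⟩ + i|1⟩)/√2`. -/
def plusI : Fin 2 → ℂ := ((Real.sqrt 2 : ℂ)⁻¹) • ![1, Complex.I]

/-- The state `|+i⟩⟨+i|`. -/
def plusIState : Matrix (Fin 2) (Fin 2) ℂ := Matrix.vecMulVec plusI (star plusI)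

/-- The gate `C(-Z) = |0⟩⟨0| ⊗ I + |1⟩⟨1| ⊗ (-Z)` on `A'B'`. -/
def ctrlNegZ : Matrix (Fin 2 × Fin 2) (Fin 2 × Fin 2) ℂ :=
  zProj 0 ⊗ₖ (1 : Matrix (Fin 2) (Fin 2) ℂ) + zProj 1 ⊗ₖ (-pauliZ)

section Encoding

variable {a b : Type*} [DecidableEq a] [DecidableEq b]

/-- The gate `C_{A'A}(U_A)`, acting trivially on `B'` and `B`. -/
def ctrlA (UA : Matrix a a ℂ) :
    Matrix ((Fin 2 × Fin 2) × (a × b)) ((Fin 2 × Fin 2) × (a × b)) ℂ :=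
  (zProj 0 ⊗ₖ (1 : Matrix (Fin 2) (Fin 2) ℂ)) ⊗ₖ
      ((1 : Matrix a a ℂ) ⊗ₖ (1 : Matrix b b ℂ)) +
    (zProj 1 ⊗ₖ (1 : Matrix (Fin 2) (Fin 2) ℂ)) ⊗ₖ (UA ⊗ₖ (1 : Matrix b b ℂ))

/-- The gate `C_{B'B}(U_B)`, acting trivially on `A'` and `A`. -/
def ctrlB (UB : Matrix b b ℂ) :
    Matrix ((Fin 2 × Fin 2) × (a × b)) ((Fin 2 × Fin 2) × (a × b)) ℂ :=
  ((1 : Matrix (Fin 2) (Fin 2) ℂ) ⊗ₖ zProj 0) ⊗ₖ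
      ((1 : Matrix a a ℂ) ⊗ₖ (1 : Matrix b b ℂ)) +
    ((1 : Matrix (Fin 2) (Fin 2) ℂ) ⊗ₖ zProj 1) ⊗ₖ ((1 : Matrix a a ℂ) ⊗ₖ UB)

/-- Both controlled gates in each of the `N` rounds, acting trivially on Eve's system `e`. -/
def encodeGate [Fintype a] [Fintype b] {e : Type*} [DecidableEq e] (N : ℕ)
    (UA : Matrix a a ℂ) (UB : Matrix b b ℂ) :
    Matrix ((Fin N → Fin 2 × Fin 2) × ((Fin N → a × b) × e))
      ((Fin N → Fin 2 × Fin 2) × ((Fin N → a × b) × e)) ℂ :=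
  Matrix.of fun x y =>
    tensorRounds (fun _ : Fin N => ctrlA UA * ctrlB UB)
        (fun m => (x.1 m, x.2.1 m)) (fun m => (y.1 m, y.2.1 m)) *
      (1 : Matrix e e ℂ) x.2.2 y.2.2

/-- The joint state of all systems after the state preparation step: in each round `A'`, `B'` are
initialized in `|+i⟩` and the controlled gates are applied. Here `ρABE` is the joint state of the
qudits of all rounds and of Eve's system before the protocol. -/
def preparedState [Fintype a] [Fintype b] {e : Type*} [Fintype e] [DecidableEq e] {N : ℕ}
    (UA : Matrix a a ℂ) (UB : Matrix b b ℂ)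
    (ρABE : Matrix ((Fin N → a × b) × e) ((Fin N → a × b) × e) ℂ) :
    Matrix ((Fin N → Fin 2 × Fin 2) × ((Fin N → a × b) × e))
      ((Fin N → Fin 2 × Fin 2) × ((Fin N → a × b) × e)) ℂ :=
  conj (encodeGate N UA UB)
    (tensorRounds (fun _ : Fin N => plusIState ⊗ₖ plusIState) ⊗ₖ ρABE)

end Encoding

/-! ### Eve's attack -/

/-- A quantum instrument in Kraus form, with input system `r`, output system `s` and classical
outcomes in `Ω`. The operation belonging to the outcome `w` is `ρ ↦ ∑ i, K_{w,i} ρ K_{w,i}†`. -/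
structure Instrument (r s Ω : Type*) [Fintype r] [Fintype s] [Fintype Ω] [DecidableEq r] where
  num : ℕ
  kraus : Ω → Fin num → Matrix s r ℂ
  complete : ∑ w, ∑ i, (kraus w i)ᴴ * kraus w i = 1

namespace Instrument

variable {q r s Ω : Type*} [Fintype q] [Fintype r] [Fintype s] [Fintype Ω]
  [DecidableEq q] [DecidableEq r]

/-- The unnormalized state after outcome `w` when the instrument acts on the second factor. -/
def apply (I : Instrument r s Ω) (ρ : Matrix (q × r) (q × r) ℂ) (w : Ω) :
    Matrix (q × s) (q × s) ℂ :=
  ∑ i, conj ((1 : Matrix q q ℂ) ⊗ₖ I.kraus w i) ρ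

/-- The probability of the outcome `w`. -/
def prob (I : Instrument r s Ω) (ρ : Matrix (q × r) (q × r) ℂ) (w : Ω) : ℂ :=
  (I.apply ρ w).trace

/-- The normalized state conditioned on the outcome `w`. -/
def condState (I : Instrument r s Ω) (ρ : Matrix (q × r) (q × r) ℂ) (w : Ω) :
    Matrix (q × s) (q × s) ℂ :=
  (I.prob ρ w)⁻¹ • I.apply ρ w

end Instrument

/-! ### Bob's correction, sifting, key generation -/

section Sifting

variable {N : ℕ} {f : Type*} [DecidableEq f] [Fintype f]

/-- Bob applies `Y` to `B'` in the rounds selected by `flip`. -/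
def bobCorrect (flip : Fin N → Bool)
    (ρ : Matrix ((Fin N → Fin 2 × Fin 2) × f) ((Fin N → Fin 2 × Fin 2) × f) ℂ) :
    Matrix ((Fin N → Fin 2 × Fin 2) × f) ((Fin N → Fin 2 × Fin 2) × f) ℂ :=
  conj (tensorRounds (fun m => (1 : Matrix (Fin 2) (Fin 2) ℂ) ⊗ₖ
    (if flip m then pauliY else 1)) ⊗ₖ (1 : Matrix f f ℂ)) ρ

/-- The rounds that are kept. -/
abbrev Kept (keep : Fin N → Bool) : Type := {m : Fin N // keep m = true}

/-- The qubits of the discarded rounds are traced out. -/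
def sift (keep : Fin N → Bool)
    (ρ : Matrix ((Fin N → Fin 2 × Fin 2) × f) ((Fin N → Fin 2 × Fin 2) × f) ℂ) :
    Matrix ((Kept keep → Fin 2 × Fin 2) × f) ((Kept keep → Fin 2 × Fin 2) × f) ℂ :=
  Matrix.of fun x y => ∑ z : {m : Fin N // ¬ keep m = true} → Fin 2 × Fin 2,
    ρ (fun m => if h : keep m = true then x.1 ⟨m, h⟩ else z ⟨m, h⟩, x.2)
      (fun m => if h : keep m = true then y.1 ⟨m, h⟩ else z ⟨m, h⟩, y.2)

variable {R : Type*} [Fintype R] [DecidableEq R]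

/-- Eve's unnormalized state when, in each round of `R`, the local projective measurements with
projectors `P` on `A'` and `Q` on `B'` have the outcomes `s` and `t`. -/
def measure (P Q : Fin 2 → Matrix (Fin 2) (Fin 2) ℂ)
    (ρ : Matrix ((R → Fin 2 × Fin 2) × f) ((R → Fin 2 × Fin 2) × f) ℂ) (s t : R → Fin 2) :
    Matrix f f ℂ :=
  traceLeft (conj (tensorRounds (fun m => P (s m) ⊗ₖ Q (t m)) ⊗ₖ (1 : Matrix f f ℂ)) ρ)

/-- The classical-quantum state `∑_{s,t} |s⟩⟨s| ⊗ ρ_E^{(s,t)}` of Alice's outcome string and Eve's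
system, Bob's outcome string `t` being discarded. -/
def aliceEve (ρ : (R → Fin 2) → (R → Fin 2) → Matrix f f ℂ) :
    Matrix ((R → Fin 2) × f) ((R → Fin 2) × f) ℂ :=
  ∑ s, ∑ t, (Matrix.single s s (1 : ℂ)) ⊗ₖ ρ s t

/-- Key generation in Protocol I: both parties measure in the `Z` basis, and the key is Alice's
outcome string. -/
def keyI (ρ : Matrix ((R → Fin 2 × Fin 2) × f) ((R → Fin 2 × Fin 2) × f) ℂ) :
    Matrix ((R → Fin 2) × f) ((R → Fin 2) × f) ℂ :=
  aliceEve (measure zProj zProj ρ)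

/-- Key generation in Protocol Ia: `C(-Z)` is applied to `A'B'` in each round, then Bob measures in
the `X` basis and Alice in the `Z` basis; the key is Alice's outcome string. -/
def keyIa (ρ : Matrix ((R → Fin 2 × Fin 2) × f) ((R → Fin 2 × Fin 2) × f) ℂ) :
    Matrix ((R → Fin 2) × f) ((R → Fin 2) × f) ℂ :=
  aliceEve (measure zProj xProj
    (conj (tensorRounds (fun _ : R => ctrlNegZ) ⊗ₖ (1 : Matrix f f ℂ)) ρ))

end Sifting

/-! ### The two protocols -/

section Protocol

variable {a b e f C : Type*} [Fintype a] [Fintype b] [Fintype e] [Fintype f] [Fintype C]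
  [DecidableEq a] [DecidableEq b] [DecidableEq e] [DecidableEq f] {N : ℕ}

/-- The common quantum part of both protocols, conditioned on Eve's announcement `c` (one symbol of
the alphabet `C` per round): the joint state of the kept qubit pairs `A'B'` and of Eve's system `f`.
Eve's instrument acts jointly on the qudits of all rounds and on her initial system `e`. Bob's
corrections and the choice of the kept rounds are functions of the announcement. -/
def siftedState (UA : Matrix a a ℂ) (UB : Matrix b b ℂ)
    (ρABE : Matrix ((Fin N → a × b) × e) ((Fin N → a × b) × e) ℂ)
    (eve : Instrument ((Fin N → a × b) × e) f (Fin N → C))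
    (flip keep : (Fin N → C) → Fin N → Bool) (c : Fin N → C) :
    Matrix ((Kept (keep c) → Fin 2 × Fin 2) × f) ((Kept (keep c) → Fin 2 × Fin 2) × f) ℂ :=
  sift (keep c) (bobCorrect (flip c) (eve.condState (preparedState UA UB ρABE) c))

/-- Joint state of the key and Eve's system in Protocol I, given the announcement `c`. -/
def protocolI (UA : Matrix a a ℂ) (UB : Matrix b b ℂ)
    (ρABE : Matrix ((Fin N → a × b) × e) ((Fin N → a × b) × e) ℂ)
    (eve : Instrument ((Fin N → a × b) × e) f (Fin N → C))
    (flip keep : (Fin N → C) → Fin N → Bool) (c : Fin N → C) :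
    Matrix ((Kept (keep c) → Fin 2) × f) ((Kept (keep c) → Fin 2) × f) ℂ :=
  keyI (siftedState UA UB ρABE eve flip keep c)

/-- Joint state of the key and Eve's system in Protocol Ia, given the announcement `c`. -/
def protocolIa (UA : Matrix a a ℂ) (UB : Matrix b b ℂ)
    (ρABE : Matrix ((Fin N → a × b) × e) ((Fin N → a × b) × e) ℂ)
    (eve : Instrument ((Fin N → a × b) × e) f (Fin N → C))
    (flip keep : (Fin N → C) → Fin N → Bool) (c : Fin N → C) :
    Matrix ((Kept (keep c) → Fin 2) × f) ((Kept (keep c) → Fin 2) × f) ℂ :=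
  keyIa (siftedState UA UB ρABE eve flip keep c)

end Protocol

/-! ### Privacy -/

section Privacy

variable {R f : Type*} [Fintype R] [DecidableEq R] [Fintype f] [DecidableEq f]

/-- The ideal private state `2^{-|R|} ∑_s |s⟩⟨s| ⊗ ρ`. -/
def privateState (R : Type*) [Fintype R] [DecidableEq R] (ρ : Matrix f f ℂ) :
    Matrix ((R → Fin 2) × f) ((R → Fin 2) × f) ℂ :=
  ((2 : ℂ) ^ Fintype.card R)⁻¹ • ∑ s : R → Fin 2, (Matrix.single s s (1 : ℂ)) ⊗ₖ ρ

/-- The trace norm `Tr √(M†M)`, that is, the sum of the singular values of `M`. -/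
def traceNorm {r : Type*} [Fintype r] [DecidableEq r] (M : Matrix r r ℂ) : ℝ :=
  ∑ i, √((Matrix.isHermitian_conjTranspose_mul_self M).eigenvalues i)

/-- `ε`-secrecy of the key. -/
def IsSecret (ε : ℝ) (ρ : Matrix ((R → Fin 2) × f) ((R → Fin 2) × f) ℂ) : Prop :=
  ∃ ρE : Matrix f f ℂ, IsState ρE ∧ (1 / 2) * traceNorm (ρ - privateState R ρE) ≤ ε

/-- Perfect privacy: the joint state of key and Eve is an ideal private state, so that the key is
uniform and independent of Eve's system. -/
def IsPerfectlyPrivate (ρ : Matrix ((R → Fin 2) × f) ((R → Fin 2) × f) ℂ) : Prop :=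
  ∃ ρE : Matrix f f ℂ, IsState ρE ∧ ρ = privateState R ρE

end Privacy

end SymQKD

end

namespace SymQKD

/-! ### Tensor products over the rounds -/

section TensorRounds

variable {R r : Type*} [Fintype R] [DecidableEq R] [Fintype r]

/-! Secrecy comes from a symmetry of the qubits that Eve cannot break. A state of definite parity is
fixed under conjugation by `U_A ⊗ U_B`, because the sign cancels, and mixtures inherit this
(`IsParityMixture.conj_eq`). Also `Y` fixes `|+i⟩`. The controlled gates carry `Y ⊗ Y ⊗ U_A ⊗ U_B`
before them to `Y ⊗ Y` on the qubits alone after them (`pauliYY_mul_ctrl`). Since rounds and Eve are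
in a product state, the prepared state is invariant under `Y ⊗ Y` on any set of rounds
(`preparedState_isSymmetric`).

The invariance survives Eve's instrument, which acts on another tensor factor, then Bob's `Y`, which
commutes with `Y ⊗ Y`, and sifting. In the key measurement it flips Alice's outcome in any chosen
rounds and at most permutes Bob's. Once Bob's outcomes are summed over, Eve's state is the same for
every key (`IsSymmetric.sum_measure_eq`). In Protocol Ia the gate `C(-Z)` first turns `Y ⊗ Y` into
`-X ⊗ X`, which flips Alice's `Z` outcome and preserves Bob's `X` outcome. -/

theorem tensorRounds_mul (M M' : R → Matrix r r ℂ) :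
    tensorRounds M * tensorRounds M' = tensorRounds fun m => M m * M' m := by
  ext x y
  simp only [tensorRounds, Matrix.mul_apply, Matrix.of_apply, ← Finset.prod_mul_distrib]
  rw [Finset.prod_univ_sum, Fintype.piFinset_univ]

omit [DecidableEq R] [Fintype r] in
theorem tensorRounds_conjTranspose (M : R → Matrix r r ℂ) :
    (tensorRounds M)ᴴ = tensorRounds fun m => (M m)ᴴ := by
  ext x y
  simp [tensorRounds, Matrix.conjTranspose_apply]

omit [DecidableEq R] [Fintype r] in
theorem tensorRounds_one [DecidableEq r] :
    tensorRounds (fun _ : R => (1 : Matrix r r ℂ)) = 1 := by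
  ext x y
  by_cases h : x = y
  · subst h
    simp [tensorRounds]
  · obtain ⟨m, hm⟩ := Function.ne_iff.mp h
    rw [Matrix.one_apply_ne h]
    exact Finset.prod_eq_zero (Finset.mem_univ m) (Matrix.one_apply_ne hm)

open scoped MatrixOrder Matrix.Norms.L2Operator in
-- Factoring each round as `B† B` makes the tensor product again of that form.
theorem tensorRounds_posSemidef {M : R → Matrix r r ℂ} (hM : ∀ m, (M m).PosSemidef) :
    (tensorRounds M).PosSemidef := by
  classical
  choose B hB using fun m => CStarAlgebra.nonneg_iff_eq_star_mul_self.mp (hM m).nonneg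
  have h : tensorRounds M = (tensorRounds B)ᴴ * tensorRounds B := by
    rw [tensorRounds_conjTranspose, tensorRounds_mul]
    exact congrArg _ (funext hB)
  rw [h]
  exact Matrix.posSemidef_conjTranspose_mul_self _

omit [Fintype r] in
-- Distributivity; it reduces sums over outcome strings to the completeness relation of a single
-- round.
theorem sum_tensorRounds {ι : Type*} [Fintype ι] (M : R → ι → Matrix r r ℂ) :
    ∑ s : R → ι, tensorRounds (fun m => M m (s m)) = tensorRounds fun m => ∑ i, M m i := by
  ext x y
  simp only [tensorRounds, Matrix.sum_apply, Matrix.of_apply]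
  rw [Finset.prod_univ_sum, Fintype.piFinset_univ]

end TensorRounds

/-! ### Conjugation and partial trace -/

section Conj

variable {q r s : Type*} [Fintype q] [Fintype r] [Fintype s]

omit [Fintype s] in
theorem conj_conj (G : Matrix s r ℂ) (H : Matrix r q ℂ) (ρ : Matrix q q ℂ) :
    conj G (conj H ρ) = conj (G * H) ρ := by
  simp only [conj, Matrix.conjTranspose_mul, Matrix.mul_assoc]

omit [Fintype s] in
theorem conj_sum {ι : Type*} (t : Finset ι) (G : Matrix s r ℂ) (ρ : ι → Matrix r r ℂ) :
    conj G (∑ i ∈ t, ρ i) = ∑ i ∈ t, conj G (ρ i) := by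
  simp only [conj, Matrix.mul_sum, Matrix.sum_mul]

omit [Fintype s] in
theorem conj_smul (z : ℂ) (G : Matrix s r ℂ) (ρ : Matrix r r ℂ) :
    conj G (z • ρ) = z • conj G ρ := by
  simp only [conj, Matrix.mul_smul, Matrix.smul_mul]

theorem conj_posSemidef (G : Matrix s r ℂ) {ρ : Matrix r r ℂ} (h : ρ.PosSemidef) :
    (conj G ρ).PosSemidef :=
  h.mul_mul_conjTranspose_same G

theorem trace_conj (G : Matrix s r ℂ) (ρ : Matrix r r ℂ) :
    (conj G ρ).trace = (Gᴴ * G * ρ).trace := by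
  rw [conj, Matrix.trace_mul_comm, Matrix.mul_assoc]

omit [Fintype s] in
theorem conj_kronecker {q' s' : Type*} [Fintype q'] (G : Matrix s r ℂ) (H : Matrix s' q' ℂ)
    (ρ : Matrix r r ℂ) (τ : Matrix q' q' ℂ) :
    conj (G ⊗ₖ H) (ρ ⊗ₖ τ) = conj G ρ ⊗ₖ conj H τ := by
  simp only [conj, Matrix.conjTranspose_kronecker, ← Matrix.mul_kronecker_mul]

theorem conj_submatrix (e : q ≃ r) (G ρ : Matrix r r ℂ) :
    conj (G.submatrix e e) (ρ.submatrix e e) = (conj G ρ).submatrix e e := by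
  simp only [conj, Matrix.conjTranspose_submatrix, Matrix.submatrix_mul_equiv]

theorem conj_tensorRounds {R : Type*} [Fintype R] [DecidableEq R] (G M : R → Matrix r r ℂ) :
    conj (tensorRounds G) (tensorRounds M) = tensorRounds fun m => conj (G m) (M m) := by
  simp only [conj, tensorRounds_conjTranspose, tensorRounds_mul]

omit [Fintype s] in
theorem traceLeft_eq_sum (ρ : Matrix (r × s) (r × s) ℂ) :
    traceLeft ρ = ∑ x, ρ.submatrix (Prod.mk x) (Prod.mk x) := by
  ext i j
  simp [traceLeft, Matrix.sum_apply]

omit [Fintype s] in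
theorem traceLeft_posSemidef {ρ : Matrix (r × s) (r × s) ℂ} (h : ρ.PosSemidef) :
    (traceLeft ρ).PosSemidef := by
  rw [traceLeft_eq_sum]
  exact Matrix.posSemidef_sum _ fun x _ => h.submatrix _

theorem trace_traceLeft (ρ : Matrix (r × s) (r × s) ℂ) : (traceLeft ρ).trace = ρ.trace := by
  simp only [Matrix.trace, traceLeft, Matrix.diag_apply, Matrix.of_apply, Fintype.sum_prod_type]
  exact Finset.sum_comm

/-- The partial trace is cyclic for operators on the traced factor. This removes the symmetry gate
once it has been moved past the measurement. -/
theorem traceLeft_conj_of_isometry [DecidableEq r] [DecidableEq s] {V : Matrix r r ℂ}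
    (hV : Vᴴ * V = 1) (ρ : Matrix (r × s) (r × s) ℂ) :
    traceLeft (conj (V ⊗ₖ (1 : Matrix s s ℂ)) ρ) = traceLeft ρ := by
  have key : ∀ y z : r, ∑ x, V x y * star (V x z) = if z = y then 1 else 0 := by
    intro y z
    have := congrFun (congrFun hV z) y
    rw [Matrix.mul_apply, Matrix.one_apply] at this
    rw [← this]
    exact Finset.sum_congr rfl fun x _ => by rw [Matrix.conjTranspose_apply, mul_comm]
  ext i j
  have h : ∀ x, conj (V ⊗ₖ (1 : Matrix s s ℂ)) ρ (x, i) (x, j)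
      = ∑ z, ∑ y, (V x y * star (V x z)) * ρ (y, i) (z, j) := by
    intro x
    simp only [conj, Matrix.mul_apply, Matrix.conjTranspose_apply, Fintype.sum_prod_type,
      Matrix.kroneckerMap_apply, Matrix.one_apply, mul_ite, ite_mul, mul_one, mul_zero, zero_mul,
      apply_ite star, star_zero, Finset.sum_ite_eq, Finset.mem_univ, if_true, Finset.sum_mul]
    exact Finset.sum_congr rfl fun z _ => Finset.sum_congr rfl fun y _ => by ring
  simp only [traceLeft, Matrix.of_apply, h]
  rw [Finset.sum_comm]
  have h' : ∀ z, ∑ x, ∑ y, (V x y * star (V x z)) * ρ (y, i) (z, j) = ρ (z, i) (z, j) := by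
    intro z
    rw [Finset.sum_comm]
    simp only [← Finset.sum_mul, key]
    simp
  simp only [h']

end Conj

/-! ### The symmetry of the kept qubits

A round symmetry `K` is applied in the rounds selected by `v : R → Fin 2`. -/

section Symmetry

variable {R q f : Type*} [Fintype R] [DecidableEq R] [Fintype q] [DecidableEq q]
  [Fintype f] [DecidableEq f]

/-- `K` applied in the rounds `m` with `v m = 1`. -/
def symGate (K : Matrix q q ℂ) (v : R → Fin 2) : Matrix (R → q) (R → q) ℂ :=
  tensorRounds fun m => K ^ (v m : ℕ)

/-- Invariance of a state under the symmetry `K` of any set of rounds. -/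
def IsSymmetric (K : Matrix q q ℂ) (ρ : Matrix ((R → q) × f) ((R → q) × f) ℂ) : Prop :=
  ∀ v : R → Fin 2, conj (symGate K v ⊗ₖ (1 : Matrix f f ℂ)) ρ = ρ

theorem pow_fin_two_induction {p : Matrix q q ℂ → Prop} {K : Matrix q q ℂ} (h0 : p 1) (h1 : p K)
    (i : Fin 2) : p (K ^ (i : ℕ)) := by
  fin_cases i
  · simpa using h0
  · simpa using h1

theorem symGate_isometry {K : Matrix q q ℂ} (hK : Kᴴ * K = 1) (v : R → Fin 2) :
    (symGate K v)ᴴ * symGate K v = 1 := by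
  rw [symGate, tensorRounds_conjTranspose, tensorRounds_mul, ← tensorRounds_one]
  exact congrArg _ (funext fun m =>
    pow_fin_two_induction (p := fun L => Lᴴ * L = 1) (by simp) hK (v m))

/-- A gate that intertwines `K` and `K'` in each round transports the symmetry. -/
theorem IsSymmetric.conj_tensorRounds {K K' : Matrix q q ℂ} {G : R → Matrix q q ℂ}
    (hG : ∀ m, K' * G m = G m * K) {ρ : Matrix ((R → q) × f) ((R → q) × f) ℂ}
    (h : IsSymmetric K ρ) :
    IsSymmetric K' (conj (tensorRounds G ⊗ₖ (1 : Matrix f f ℂ)) ρ) := by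
  intro v
  have hc : symGate K' v * tensorRounds G = tensorRounds G * symGate K v := by
    rw [symGate, symGate, tensorRounds_mul, tensorRounds_mul]
    refine congrArg _ (funext fun m => ?_)
    generalize v m = i
    fin_cases i
    · simp
    · simpa using hG m
  rw [conj_conj, ← Matrix.mul_kronecker_mul, hc, Matrix.mul_kronecker_mul, ← conj_conj, h v]

/-- Eve's Kraus operators and the symmetry act on different tensor factors, hence commute. An
outcome of probability zero needs no exception, since normalization is only a scalar factor. -/
theorem IsSymmetric.instrument_condState {r Ω : Type*} [Fintype r] [DecidableEq r] [Fintype Ω]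
    {K : Matrix q q ℂ} {ρ : Matrix ((R → q) × r) ((R → q) × r) ℂ} (h : IsSymmetric K ρ)
    (I : Instrument r f Ω) (w : Ω) : IsSymmetric K (I.condState ρ w) := by
  intro v
  simp only [Instrument.condState, Instrument.apply, conj_smul, conj_sum]
  congr 1
  refine Finset.sum_congr rfl fun i _ => ?_
  have hc : (symGate K v ⊗ₖ (1 : Matrix f f ℂ)) * ((1 : Matrix (R → q) (R → q) ℂ) ⊗ₖ I.kraus w i)
      = ((1 : Matrix (R → q) (R → q) ℂ) ⊗ₖ I.kraus w i) * (symGate K v ⊗ₖ (1 : Matrix r r ℂ)) := by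
    simp only [← Matrix.mul_kronecker_mul, Matrix.one_mul, Matrix.mul_one]
  rw [conj_conj, hc, ← conj_conj, h v]

end Symmetry

/-! ### Sifting -/

section Sift

variable {N : ℕ} {f : Type*} [DecidableEq f] [Fintype f]

/-- The string over all rounds obtained from its kept and its discarded part. -/
def mergeRounds {q : Type*} (keep : Fin N → Bool)
    (p : (Kept keep → q) × ({m : Fin N // ¬ keep m = true} → q)) : Fin N → q :=
  (Equiv.piEquivPiSubtypeProd (fun m => keep m = true) fun _ => q).symm p

/-- The operator that projects the discarded qubits onto `z` and removes them. -/
def siftKraus (keep : Fin N → Bool) (z : {m : Fin N // ¬ keep m = true} → Fin 2 × Fin 2) :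
    Matrix (Kept keep → Fin 2 × Fin 2) (Fin N → Fin 2 × Fin 2) ℂ :=
  (1 : Matrix (Fin N → Fin 2 × Fin 2) (Fin N → Fin 2 × Fin 2) ℂ).submatrix
    (fun x => mergeRounds keep (x, z)) id

omit [DecidableEq f] [Fintype f] in
theorem sift_eq_sum_submatrix (keep : Fin N → Bool)
    (ρ : Matrix ((Fin N → Fin 2 × Fin 2) × f) ((Fin N → Fin 2 × Fin 2) × f) ℂ) :
    sift keep ρ = ∑ z, ρ.submatrix (fun x => (mergeRounds keep (x.1, z), x.2))
      fun x => (mergeRounds keep (x.1, z), x.2) := by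
  ext x y
  rw [Matrix.sum_apply]
  rfl

theorem sift_eq_sum_conj (keep : Fin N → Bool)
    (ρ : Matrix ((Fin N → Fin 2 × Fin 2) × f) ((Fin N → Fin 2 × Fin 2) × f) ℂ) :
    sift keep ρ = ∑ z, conj (siftKraus keep z ⊗ₖ (1 : Matrix f f ℂ)) ρ := by
  rw [sift_eq_sum_submatrix]
  refine Finset.sum_congr rfl fun z _ => ?_
  have h : siftKraus keep z ⊗ₖ (1 : Matrix f f ℂ)
      = (1 : Matrix ((Fin N → Fin 2 × Fin 2) × f) ((Fin N → Fin 2 × Fin 2) × f) ℂ).submatrix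
        (fun x => (mergeRounds keep (x.1, z), x.2)) id := by
    rw [← Matrix.one_kronecker_one]
    rfl
  rw [h, conj, Matrix.conjTranspose_submatrix, Matrix.conjTranspose_one]
  ext x y
  simp [Matrix.mul_apply, Matrix.one_apply]

/-- Extending `v` by `0` puts `K ^ 0 = 1` in the discarded rounds, so the projection onto `z` is not
disturbed. -/
theorem symGate_mul_siftKraus (K : Matrix (Fin 2 × Fin 2) (Fin 2 × Fin 2) ℂ) (keep : Fin N → Bool)
    (z : {m : Fin N // ¬ keep m = true} → Fin 2 × Fin 2) (v : Kept keep → Fin 2) :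
    symGate K v * siftKraus keep z
      = siftKraus keep z * symGate K (mergeRounds keep (v, fun _ => 0)) := by
  ext x w
  obtain ⟨⟨w₁, w₂⟩, rfl⟩ := (Equiv.piEquivPiSubtypeProd (fun m => keep m = true)
    fun _ => Fin 2 × Fin 2).symm.surjective w
  have hl : (symGate K v * siftKraus keep z) x (mergeRounds keep (w₁, w₂))
      = symGate K v x w₁ * (1 : Matrix _ _ ℂ) z w₂ := by
    have h : ∀ x', siftKraus keep z x' (mergeRounds keep (w₁, w₂))
        = if x' = w₁ then (1 : Matrix _ _ ℂ) z w₂ else 0 := by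
      intro x'
      simp only [siftKraus, mergeRounds, Matrix.submatrix_apply, id, Matrix.one_apply,
        EmbeddingLike.apply_eq_iff_eq, Prod.mk.injEq]
      split_ifs <;> simp_all
    simp [Matrix.mul_apply, h]
  have hr : (siftKraus keep z * symGate K (mergeRounds keep (v, fun _ => 0))) x
      (mergeRounds keep (w₁, w₂)) = symGate K v x w₁ * (1 : Matrix _ _ ℂ) z w₂ := by
    have h : (siftKraus keep z * symGate K (mergeRounds keep (v, fun _ => 0))) x
        (mergeRounds keep (w₁, w₂)) = symGate K (mergeRounds keep (v, fun _ => 0))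
          (mergeRounds keep (x, z)) (mergeRounds keep (w₁, w₂)) := by
      simp [Matrix.mul_apply, siftKraus, Matrix.one_apply]
    -- With the Kronecker delta of `z` and `w₂` written as a product over the discarded rounds, the
    -- two sides match round by round.
    rw [h, ← tensorRounds_one]
    simp only [symGate, tensorRounds, Matrix.of_apply]
    rw [← Fintype.prod_subtype_mul_prod_subtype (fun m => keep m = true)]
    congr 1
    · refine Finset.prod_congr rfl fun m _ => ?_
      simp [mergeRounds, Equiv.piEquivPiSubtypeProd, m.2]
    · refine Finset.prod_congr rfl fun m _ => ?_
      simp [mergeRounds, Equiv.piEquivPiSubtypeProd, m.2]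
  exact hl.trans hr.symm

theorem IsSymmetric.sift {K : Matrix (Fin 2 × Fin 2) (Fin 2 × Fin 2) ℂ}
    {ρ : Matrix ((Fin N → Fin 2 × Fin 2) × f) ((Fin N → Fin 2 × Fin 2) × f) ℂ}
    (h : IsSymmetric K ρ) (keep : Fin N → Bool) : IsSymmetric K (sift keep ρ) := by
  intro v
  rw [sift_eq_sum_conj, conj_sum]
  refine Finset.sum_congr rfl fun z _ => ?_
  rw [conj_conj, ← Matrix.mul_kronecker_mul, symGate_mul_siftKraus, Matrix.mul_kronecker_mul,
    ← conj_conj, h]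

omit [DecidableEq f] in
theorem IsState.sift {ρ : Matrix ((Fin N → Fin 2 × Fin 2) × f) ((Fin N → Fin 2 × Fin 2) × f) ℂ}
    (h : IsState ρ) (keep : Fin N → Bool) : IsState (sift keep ρ) := by
  refine ⟨?_, ?_⟩
  · rw [sift_eq_sum_submatrix]
    exact Matrix.posSemidef_sum _ fun z _ => h.1.submatrix _
  · rw [← h.2, sift_eq_sum_submatrix, Matrix.trace_sum]
    simp only [Matrix.trace, Matrix.diag_apply, Matrix.submatrix_apply, Fintype.sum_prod_type]
    rw [Finset.sum_comm, ← Fintype.sum_prod_type']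
    exact Equiv.sum_comp (Equiv.piEquivPiSubtypeProd (fun m => keep m = true)
      fun _ => Fin 2 × Fin 2).symm fun w => ∑ j, ρ (w, j) (w, j)

theorem IsState.conj_of_isometry {r : Type*} [Fintype r] [DecidableEq r] {G ρ : Matrix r r ℂ}
    (hG : Gᴴ * G = 1) (h : IsState ρ) : IsState (conj G ρ) :=
  ⟨conj_posSemidef G h.1, by rw [trace_conj, hG, Matrix.one_mul, h.2]⟩

theorem tensorRounds_kronecker_one_isometry {R r : Type*} [Fintype R] [DecidableEq R] [Fintype r]
    [DecidableEq r] {G : R → Matrix r r ℂ} (hG : ∀ m, (G m)ᴴ * G m = 1) :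
    (tensorRounds G ⊗ₖ (1 : Matrix f f ℂ))ᴴ * (tensorRounds G ⊗ₖ (1 : Matrix f f ℂ)) = 1 := by
  rw [Matrix.conjTranspose_kronecker, ← Matrix.mul_kronecker_mul, tensorRounds_conjTranspose,
    tensorRounds_mul, funext hG, tensorRounds_one]
  simp

omit [DecidableEq f] in
theorem instrument_condState_isState {q r Ω : Type*} [Fintype q] [DecidableEq q] [Fintype r]
    [DecidableEq r] [Fintype Ω] (I : Instrument r f Ω) {ρ : Matrix (q × r) (q × r) ℂ}
    (hρ : ρ.PosSemidef) {w : Ω} (hw : I.prob ρ w ≠ 0) : IsState (I.condState ρ w) := by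
  have hp : (I.apply ρ w).PosSemidef :=
    Matrix.posSemidef_sum _ fun i _ => conj_posSemidef _ hρ
  refine ⟨hp.smul ?_, ?_⟩
  -- The probability is a complex number; its inverse preserves positivity because it is real and
  -- nonnegative.
  · have h0 : 0 ≤ I.prob ρ w := hp.trace_nonneg
    obtain ⟨hre, him⟩ := Complex.nonneg_iff.mp h0
    have he : I.prob ρ w = ((I.prob ρ w).re : ℂ) := Complex.ext rfl (by simp [← him])
    rw [he, ← Complex.ofReal_inv]
    exact Complex.zero_le_real.mpr (inv_nonneg.mpr hre)
  · rw [Instrument.condState, Matrix.trace_smul, smul_eq_mul]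
    exact inv_mul_cancel₀ hw

end Sift

/-! ### The prepared state -/

section Prepared

variable {a b : Type*} [Fintype a] [Fintype b] [DecidableEq a] [DecidableEq b]

theorem pauliY_mul_zProj_zero : pauliY * zProj 0 = zProj 1 * pauliY := by
  ext i j
  fin_cases i <;> fin_cases j <;> simp [pauliY, zProj, Matrix.mul_apply, Matrix.single_apply]

theorem pauliY_mul_zProj_one : pauliY * zProj 1 = zProj 0 * pauliY := by
  ext i j
  fin_cases i <;> fin_cases j <;> simp [pauliY, zProj, Matrix.mul_apply, Matrix.single_apply]

theorem pauliY_conjTranspose : pauliYᴴ = pauliY := by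
  ext i j
  fin_cases i <;> fin_cases j <;> simp [pauliY]

theorem pauliY_mul_self : pauliY * pauliY = 1 := by
  ext i j
  fin_cases i <;> fin_cases j <;> simp [pauliY, Matrix.mul_apply]

/-- `|+i⟩` is the eigenvector of `Y` with eigenvalue `1`. -/
theorem conj_pauliY_plusIState : conj pauliY plusIState = plusIState := by
  have h : pauliY *ᵥ plusI = plusI := by
    ext i
    fin_cases i
    · simp [pauliY, plusI, Matrix.mulVec, dotProduct, mul_left_comm Complex.I]
    · simp [pauliY, plusI, Matrix.mulVec, dotProduct, mul_comm Complex.I]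
  rw [conj, plusIState, Matrix.mul_vecMulVec, Matrix.vecMulVec_mul, ← Matrix.star_mulVec, h]

/-- The symmetry `Y ⊗ Y` of the qubits is transferred to the symmetry `U_A ⊗ U_B` of the qudits. -/
theorem pauliYY_mul_ctrl {UA : Matrix a a ℂ} (hUA : UA * UA = 1) {UB : Matrix b b ℂ}
    (hUB : UB * UB = 1) :
    ((pauliY ⊗ₖ pauliY) ⊗ₖ (1 : Matrix (a × b) (a × b) ℂ)) * (ctrlA UA * ctrlB UB)
      = (ctrlA UA * ctrlB UB) * ((pauliY ⊗ₖ pauliY) ⊗ₖ (UA ⊗ₖ UB)) := by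
  rw [← Matrix.one_kronecker_one]
  simp only [ctrlA, ctrlB, Matrix.mul_add, Matrix.add_mul, ← Matrix.mul_kronecker_mul,
    Matrix.one_mul, Matrix.mul_one, pauliY_mul_zProj_zero, pauliY_mul_zProj_one, hUA, hUB]
  abel

/-- On a state of definite parity `U_A ⊗ U_B` acts from either side as the same sign `±1`, and the
two signs cancel. Positivity and invariance are convex conditions, so they pass to the convex hull.
-/
theorem IsParityMixture.conj_eq {UA : Matrix a a ℂ} {UB : Matrix b b ℂ}
    {σ : Matrix (a × b) (a × b) ℂ} (hσ : IsParityMixture UA UB σ) :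
    σ.PosSemidef ∧ conj (UA ⊗ₖ UB) σ = σ := by
  have hconv : Convex ℝ {τ : Matrix (a × b) (a × b) ℂ |
      τ.PosSemidef ∧ conj (UA ⊗ₖ UB) τ = τ} := by
    rintro x ⟨hx, hx'⟩ y ⟨hy, hy'⟩ α β hα hβ -
    refine ⟨(hx.smul hα).add (hy.smul hβ), ?_⟩
    have : conj (UA ⊗ₖ UB) (α • x + β • y)
        = α • conj (UA ⊗ₖ UB) x + β • conj (UA ⊗ₖ UB) y := by
      simp only [conj, Matrix.mul_add, Matrix.add_mul, Matrix.mul_smul, Matrix.smul_mul]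
    rw [this, hx', hy']
  have hmul : ∀ (μ : ℂ) (τ : Matrix (a × b) (a × b) ℂ), LinearMap.range (Matrix.toLin' τ) ≤
      Module.End.eigenspace (Matrix.toLin' (UA ⊗ₖ UB)) μ → (UA ⊗ₖ UB) * τ = μ • τ := by
    intro μ τ h
    apply Matrix.toLin'.injective
    ext1 x
    have := Module.End.mem_eigenspace_iff.mp (h ⟨Pi.single x 1, rfl⟩)
    ext i
    simpa [Matrix.toLin'_mul] using congrFun this i
  have hsym : ∀ (μ : ℂ) (τ : Matrix (a × b) (a × b) ℂ), μ * star μ = 1 → τ.PosSemidef →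
      (UA ⊗ₖ UB) * τ = μ • τ → conj (UA ⊗ₖ UB) τ = τ := by
    intro μ τ hμ hτ h
    -- The adjoint of `h`, as `τ` is Hermitian.
    have h' : τ * (UA ⊗ₖ UB)ᴴ = star μ • τ := by
      rw [← Matrix.conjTranspose_inj, Matrix.conjTranspose_mul, Matrix.conjTranspose_conjTranspose,
        hτ.1.eq, h, Matrix.conjTranspose_smul, hτ.1.eq, star_star]
    rw [conj, h, Matrix.smul_mul, h', smul_smul, hμ, one_smul]
  refine convexHull_min ?_ hconv hσ
  rintro τ (⟨hτ, h⟩ | ⟨hτ, h⟩)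
  · exact ⟨hτ.1, hsym (-1) τ (by simp) hτ.1 (hmul _ _ h)⟩
  · exact ⟨hτ.1, hsym 1 τ (by simp) hτ.1 (hmul _ _ h)⟩

/-- Rearrangement of the systems into one composite system per round. -/
def roundEquiv (N : ℕ) (q d e : Type*) : (Fin N → q) × ((Fin N → d) × e) ≃ (Fin N → q × d) × e :=
  (Equiv.prodAssoc _ _ _).symm.trans
    ((Equiv.arrowProdEquivProdArrow (Fin N) (fun _ => q) (fun _ => d)).symm.prodCongr
      (Equiv.refl e))

variable {e : Type*} [Fintype e] [DecidableEq e] {N : ℕ}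

/-- With the systems regrouped by rounds, initial state and gates are both products, so invariance
can be checked in one round. -/
theorem preparedState_eq_submatrix (UA : Matrix a a ℂ) (UB : Matrix b b ℂ)
    (σ : Fin N → Matrix (a × b) (a × b) ℂ) (ρE : Matrix e e ℂ) :
    preparedState UA UB (tensorRounds σ ⊗ₖ ρE)
      = (tensorRounds (fun m => conj (ctrlA UA * ctrlB UB) ((plusIState ⊗ₖ plusIState) ⊗ₖ σ m))
          ⊗ₖ ρE).submatrix (roundEquiv N _ _ e) (roundEquiv N _ _ e) := by
  have h1 : encodeGate N UA UB = (tensorRounds (fun _ : Fin N => ctrlA UA * ctrlB UB)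
      ⊗ₖ (1 : Matrix e e ℂ)).submatrix (roundEquiv N _ _ e) (roundEquiv N _ _ e) := rfl
  have h2 : tensorRounds (fun _ : Fin N => plusIState ⊗ₖ plusIState) ⊗ₖ (tensorRounds σ ⊗ₖ ρE)
      = (tensorRounds (fun m => (plusIState ⊗ₖ plusIState) ⊗ₖ σ m) ⊗ₖ ρE).submatrix
        (roundEquiv N _ _ e) (roundEquiv N _ _ e) := by
    ext x y
    simp [tensorRounds, roundEquiv, Finset.prod_mul_distrib, mul_assoc,
      Equiv.arrowProdEquivProdArrow]
  rw [preparedState, h1, h2, conj_submatrix, conj_kronecker, conj_tensorRounds]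
  simp [conj]

theorem preparedState_posSemidef (UA : Matrix a a ℂ) (UB : Matrix b b ℂ)
    {ρ : Matrix ((Fin N → a × b) × e) ((Fin N → a × b) × e) ℂ} (hρ : ρ.PosSemidef) :
    (preparedState UA UB ρ).PosSemidef := by
  have hp : plusIState.PosSemidef := Matrix.posSemidef_vecMulVec_self_star _
  exact conj_posSemidef _ ((tensorRounds_posSemidef fun _ => hp.kronecker hp).kronecker hρ)

theorem preparedState_isSymmetric {UA : Matrix a a ℂ} (hUA : UA * UA = 1) {UB : Matrix b b ℂ}
    (hUB : UB * UB = 1) {σ : Fin N → Matrix (a × b) (a × b) ℂ}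
    (hσ : ∀ m, conj (UA ⊗ₖ UB) (σ m) = σ m) (ρE : Matrix e e ℂ) :
    IsSymmetric (pauliY ⊗ₖ pauliY) (preparedState UA UB (tensorRounds σ ⊗ₖ ρE)) := by
  intro v
  have h1 : symGate (pauliY ⊗ₖ pauliY) v ⊗ₖ (1 : Matrix ((Fin N → a × b) × e) _ ℂ)
      = (tensorRounds (fun m => ((pauliY ⊗ₖ pauliY) ^ (v m : ℕ)) ⊗ₖ
          (1 : Matrix (a × b) (a × b) ℂ)) ⊗ₖ (1 : Matrix e e ℂ)).submatrix
        (roundEquiv N _ _ e) (roundEquiv N _ _ e) := by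
    rw [← Matrix.one_kronecker_one, ← tensorRounds_one]
    ext x y
    simp [symGate, tensorRounds, roundEquiv, Finset.prod_mul_distrib, mul_assoc,
      Equiv.arrowProdEquivProdArrow]
  rw [preparedState_eq_submatrix, h1, conj_submatrix, conj_kronecker, conj_tensorRounds]
  congr 2
  · refine congrArg _ (funext fun m => ?_)
    refine pow_fin_two_induction (p := fun L => conj (L ⊗ₖ (1 : Matrix (a × b) (a × b) ℂ))
      (conj (ctrlA UA * ctrlB UB) ((plusIState ⊗ₖ plusIState) ⊗ₖ σ m))
        = conj (ctrlA UA * ctrlB UB) ((plusIState ⊗ₖ plusIState) ⊗ₖ σ m)) ?_ ?_ (v m)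
    · rw [Matrix.one_kronecker_one]
      simp [conj]
    -- Pulled back through the gates, the symmetry acts on the initial state, where each tensor
    -- factor is invariant.
    · rw [conj_conj, pauliYY_mul_ctrl hUA hUB, ← conj_conj, conj_kronecker, conj_kronecker,
        conj_pauliY_plusIState, hσ]
  · simp [conj]

end Prepared

/-! ### Measurement -/

section Measure

variable {R f : Type*} [Fintype R] [DecidableEq R] [Fintype f] [DecidableEq f]

/-- The qubit measurement with operators `P` is a projective measurement. -/
structure IsProjMeasurement (P : Fin 2 → Matrix (Fin 2) (Fin 2) ℂ) : Prop where
  isProj : ∀ s, (P s)ᴴ * P s = P s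
  sum_eq_one : ∑ s, P s = 1

theorem isProjMeasurement_zProj : IsProjMeasurement zProj where
  isProj s := by
    ext i j
    fin_cases s <;> fin_cases i <;> fin_cases j <;>
      simp [zProj, Matrix.mul_apply, Matrix.single_apply]
  sum_eq_one := by
    ext i j
    fin_cases i <;> fin_cases j <;> simp [zProj]

theorem isProjMeasurement_xProj : IsProjMeasurement xProj where
  isProj s := by
    ext i j
    fin_cases s <;> fin_cases i <;> fin_cases j <;>
      simp [xProj, Matrix.mul_apply, Complex.conj_ofNat] <;> norm_num
  sum_eq_one := by
    ext i j
    fin_cases i <;> fin_cases j <;> simp [xProj] <;> norm_num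

variable {P Q : Fin 2 → Matrix (Fin 2) (Fin 2) ℂ}
  {ρ : Matrix ((R → Fin 2 × Fin 2) × f) ((R → Fin 2 × Fin 2) × f) ℂ}

theorem measure_posSemidef (hρ : ρ.PosSemidef) (s t : R → Fin 2) :
    (measure P Q ρ s t).PosSemidef :=
  traceLeft_posSemidef (conj_posSemidef _ hρ)

/-- The outcome probabilities add up to the trace because the product projectors sum to `1`; this
fixes the normalization of Eve's final state. -/
theorem sum_trace_measure (hP : IsProjMeasurement P) (hQ : IsProjMeasurement Q) :
    ∑ s, ∑ t, (measure P Q ρ s t).trace = ρ.trace := by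
  have h : ∀ s t, (measure P Q ρ s t).trace
      = ((tensorRounds (fun m => P (s m) ⊗ₖ Q (t m)) ⊗ₖ (1 : Matrix f f ℂ)) * ρ).trace := by
    intro s t
    rw [measure, trace_traceLeft, trace_conj, Matrix.conjTranspose_kronecker,
      ← Matrix.mul_kronecker_mul, tensorRounds_conjTranspose, tensorRounds_mul]
    simp only [Matrix.conjTranspose_kronecker, ← Matrix.mul_kronecker_mul, hP.isProj, hQ.isProj,
      Matrix.conjTranspose_one, Matrix.one_mul]
  have hsum : ∑ s : R → Fin 2, ∑ t : R → Fin 2, tensorRounds (fun m => P (s m) ⊗ₖ Q (t m)) = 1 := by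
    have hQ' : ∀ s : R → Fin 2, ∑ t : R → Fin 2, tensorRounds (fun m => P (s m) ⊗ₖ Q (t m))
        = tensorRounds fun m => P (s m) ⊗ₖ (1 : Matrix (Fin 2) (Fin 2) ℂ) := by
      intro s
      rw [sum_tensorRounds fun m i => P (s m) ⊗ₖ Q i]
      refine congrArg _ (funext fun m => ?_)
      rw [← hQ.sum_eq_one]
      simp [Fin.sum_univ_two, Matrix.kronecker_add]
    simp only [hQ']
    rw [sum_tensorRounds fun _ i => P i ⊗ₖ (1 : Matrix (Fin 2) (Fin 2) ℂ), ← tensorRounds_one]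
    refine congrArg _ (funext fun m => ?_)
    rw [← Matrix.one_kronecker_one, ← hP.sum_eq_one]
    simp [Fin.sum_univ_two, Matrix.add_kronecker]
  have hsum' : ∑ s : R → Fin 2, ∑ t : R → Fin 2,
      (tensorRounds (fun m => P (s m) ⊗ₖ Q (t m)) ⊗ₖ (1 : Matrix f f ℂ)) = 1 := by
    rw [← Matrix.one_kronecker_one, ← hsum]
    ext x y
    simp only [Matrix.sum_apply, Matrix.kroneckerMap_apply, Finset.sum_mul]
  simp only [h, ← Matrix.trace_sum, ← Matrix.sum_mul, hsum', Matrix.one_mul]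

/-- If the round symmetry `K` flips Alice's outcome and permutes Bob's outcomes, Eve's state does
not depend on Alice's outcome string. -/
theorem IsSymmetric.sum_measure_eq {K : Matrix (Fin 2 × Fin 2) (Fin 2 × Fin 2) ℂ}
    (hK : Kᴴ * K = 1) (hρ : IsSymmetric K ρ) {π : Fin 2 → Equiv.Perm (Fin 2)} (hπ : π 0 = 1)
    (hPQ : ∀ s t, (P s ⊗ₖ Q t) * K = K * (P (s + 1) ⊗ₖ Q (π 1 t))) (s s' : R → Fin 2) :
    ∑ t, measure P Q ρ s t = ∑ t, measure P Q ρ s' t := by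
  -- The rounds where the two keys differ; in `Fin 2`, adding `1` is the flip.
  set v : R → Fin 2 := s' - s with hv
  have key : ∀ t, measure P Q ρ s t = measure P Q ρ s' fun m => π (v m) (t m) := by
    intro t
    have hc : tensorRounds (fun m => P (s m) ⊗ₖ Q (t m)) * symGate K v
        = symGate K v * tensorRounds (fun m => P (s' m) ⊗ₖ Q (π (v m) (t m))) := by
      rw [symGate, tensorRounds_mul, tensorRounds_mul]
      refine congrArg _ (funext fun m => ?_)
      have hs : s' m = s m + v m := by simp [hv]
      rw [hs]
      generalize v m = i
      fin_cases i
      · simp [hπ]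
      · simpa using hPQ (s m) (t m)
    -- The symmetry gate is inserted next to `ρ`, moved through the projectors, which changes the
    -- outcomes, and dropped under the partial trace.
    conv_lhs => rw [measure, ← hρ v]
    rw [conj_conj, ← Matrix.mul_kronecker_mul, hc, Matrix.mul_kronecker_mul, ← conj_conj,
      traceLeft_conj_of_isometry (symGate_isometry hK v), measure]
  simp only [key]
  -- Summing over Bob's outcomes is essential here: his strings are only permuted.
  exact Equiv.sum_comp (Equiv.piCongrRight fun m => π (v m)) fun t => measure P Q ρ s' t

/-! ### From key-independent states to privacy -/

theorem traceNorm_zero {r : Type*} [Fintype r] [DecidableEq r] :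
    traceNorm (0 : Matrix r r ℂ) = 0 := by
  refine Finset.sum_eq_zero fun i _ => ?_
  have h := (Matrix.isHermitian_conjTranspose_mul_self (0 : Matrix r r ℂ)).eigenvalues_eq i
  rw [h]
  simp

theorem IsPerfectlyPrivate.isSecret {ρ : Matrix ((R → Fin 2) × f) ((R → Fin 2) × f) ℂ}
    (h : IsPerfectlyPrivate ρ) : IsSecret 0 ρ := by
  obtain ⟨ρE, hE, rfl⟩ := h
  exact ⟨ρE, hE, by rw [sub_self, traceNorm_zero, mul_zero]⟩

theorem IsState.isPerfectlyPrivate_aliceEve (hρ : IsState ρ) (hP : IsProjMeasurement P)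
    (hQ : IsProjMeasurement Q)
    (h : ∀ s s', ∑ t, measure P Q ρ s t = ∑ t, measure P Q ρ s' t) :
    IsPerfectlyPrivate (aliceEve (measure P Q ρ)) := by
  set τ := ∑ t, measure P Q ρ 0 t with hτ
  have hcard : (2 : ℂ) ^ Fintype.card R ≠ 0 := pow_ne_zero _ two_ne_zero
  have htr : (2 : ℂ) ^ Fintype.card R * τ.trace = 1 := by
    rw [← hρ.2, ← sum_trace_measure (ρ := ρ) hP hQ]
    simp only [← Matrix.trace_sum, h _ 0, ← hτ]
    rw [Finset.sum_const, Matrix.trace_smul]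
    simp
  -- All `2^|R|` keys share the unnormalized state `τ`, so `τ` has trace `2^{-|R|}`.
  refine ⟨(2 : ℂ) ^ Fintype.card R • τ, ⟨?_, ?_⟩, ?_⟩
  · refine (Matrix.posSemidef_sum _ fun t _ => measure_posSemidef hρ.1 0 t).smul ?_
    exact pow_nonneg zero_le_two _
  · rw [Matrix.trace_smul, smul_eq_mul, htr]
  · simp only [privateState, aliceEve, Matrix.kronecker_smul, ← Finset.smul_sum, smul_smul,
      inv_mul_cancel₀ hcard, one_smul]
    refine Finset.sum_congr rfl fun s _ => ?_
    rw [hτ, h 0 s]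
    ext x y
    simp only [Matrix.sum_apply, Matrix.kroneckerMap_apply, Finset.mul_sum]

/-! ### The symmetry in the two key measurements -/

theorem pauliYY_isometry : (pauliY ⊗ₖ pauliY)ᴴ * (pauliY ⊗ₖ pauliY) = 1 := by
  rw [Matrix.conjTranspose_kronecker, ← Matrix.mul_kronecker_mul, pauliY_conjTranspose,
    pauliY_mul_self, Matrix.one_kronecker_one]

theorem zProj_mul_pauliY (s : Fin 2) : zProj s * pauliY = pauliY * zProj (s + 1) := by
  fin_cases s
  · exact pauliY_mul_zProj_one.symm
  · exact pauliY_mul_zProj_zero.symm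

theorem IsSymmetric.keyI_isPerfectlyPrivate (hρ : IsState ρ)
    (h : IsSymmetric (pauliY ⊗ₖ pauliY) ρ) : IsPerfectlyPrivate (keyI ρ) := by
  refine hρ.isPerfectlyPrivate_aliceEve isProjMeasurement_zProj isProjMeasurement_zProj ?_
  -- `Y ⊗ Y` flips both `Z` outcomes, so Bob's permutation is also `t ↦ t + 1`.
  refine h.sum_measure_eq pauliYY_isometry (π := fun i => Equiv.addRight i) (by ext; simp) ?_
  intro s t
  rw [← Matrix.mul_kronecker_mul, ← Matrix.mul_kronecker_mul, zProj_mul_pauliY, zProj_mul_pauliY]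
  rfl

/-- The Pauli operator `X`. -/
def pauliX : Matrix (Fin 2) (Fin 2) ℂ := !![0, 1; 1, 0]

theorem pauliX_isometry : pauliXᴴ * pauliX = 1 := by
  ext i j
  fin_cases i <;> fin_cases j <;> simp [pauliX, Matrix.mul_apply]

theorem zProj_mul_pauliX (s : Fin 2) : zProj s * pauliX = pauliX * zProj (s + 1) := by
  ext i j
  fin_cases s <;> fin_cases i <;> fin_cases j <;>
    simp [pauliX, zProj, Matrix.mul_apply, Matrix.single_apply]

theorem xProj_mul_pauliX (s : Fin 2) : xProj s * pauliX = pauliX * xProj s := by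
  ext i j
  fin_cases s <;> fin_cases i <;> fin_cases j <;> simp [pauliX, xProj, Matrix.mul_apply]

theorem ctrlNegZ_isometry : ctrlNegZᴴ * ctrlNegZ = 1 := by
  ext ⟨i, i'⟩ ⟨j, j'⟩
  fin_cases i <;> fin_cases i' <;> fin_cases j <;> fin_cases j' <;>
    simp [ctrlNegZ, zProj, pauliZ, Matrix.mul_apply, Fintype.sum_prod_type, Matrix.single_apply]

/-- The overall sign is invisible under conjugation, so after the gate the effective symmetry is `X
⊗ X`. -/
theorem pauliXX_mul_ctrlNegZ :
    (-(pauliX ⊗ₖ pauliX)) * ctrlNegZ = ctrlNegZ * (pauliY ⊗ₖ pauliY) := by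
  ext ⟨i, i'⟩ ⟨j, j'⟩
  fin_cases i <;> fin_cases i' <;> fin_cases j <;> fin_cases j' <;>
    simp [ctrlNegZ, zProj, pauliX, pauliY, pauliZ, Matrix.mul_apply, Fintype.sum_prod_type,
      Matrix.single_apply]

theorem IsSymmetric.keyIa_isPerfectlyPrivate (hρ : IsState ρ)
    (h : IsSymmetric (pauliY ⊗ₖ pauliY) ρ) : IsPerfectlyPrivate (keyIa ρ) := by
  refine (hρ.conj_of_isometry (tensorRounds_kronecker_one_isometry fun _ =>
    ctrlNegZ_isometry)).isPerfectlyPrivate_aliceEve isProjMeasurement_zProj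
      isProjMeasurement_xProj ?_
  have h' : IsSymmetric (-(pauliX ⊗ₖ pauliX))
      (conj (tensorRounds (fun _ : R => ctrlNegZ) ⊗ₖ (1 : Matrix f f ℂ)) ρ) :=
    h.conj_tensorRounds fun _ => pauliXX_mul_ctrlNegZ
  -- `X` commutes with Bob's `X`-basis projectors, so his outcomes are not permuted.
  refine h'.sum_measure_eq ?_ (π := fun _ => 1) rfl ?_
  · rw [Matrix.conjTranspose_neg, neg_mul_neg, Matrix.conjTranspose_kronecker,
      ← Matrix.mul_kronecker_mul, pauliX_isometry, Matrix.one_kronecker_one]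
  · intro s t
    rw [mul_neg, neg_mul, ← Matrix.mul_kronecker_mul, ← Matrix.mul_kronecker_mul,
      zProj_mul_pauliX, xProj_mul_pauliX]
    rfl

/-- Each correction is `1 ⊗ Y` or the identity, and both commute with `Y ⊗ Y`. -/
theorem IsSymmetric.bobCorrect {N : ℕ}
    {ρ : Matrix ((Fin N → Fin 2 × Fin 2) × f) ((Fin N → Fin 2 × Fin 2) × f) ℂ}
    (h : IsSymmetric (pauliY ⊗ₖ pauliY) ρ) (flip : Fin N → Bool) :
    IsSymmetric (pauliY ⊗ₖ pauliY) (bobCorrect flip ρ) := by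
  refine h.conj_tensorRounds fun m => ?_
  rw [← Matrix.mul_kronecker_mul, ← Matrix.mul_kronecker_mul]
  split_ifs <;> simp

theorem IsState.bobCorrect {N : ℕ}
    {ρ : Matrix ((Fin N → Fin 2 × Fin 2) × f) ((Fin N → Fin 2 × Fin 2) × f) ℂ}
    (h : IsState ρ) (flip : Fin N → Bool) : IsState (bobCorrect flip ρ) := by
  refine h.conj_of_isometry (tensorRounds_kronecker_one_isometry fun m => ?_)
  rw [Matrix.conjTranspose_kronecker, ← Matrix.mul_kronecker_mul]
  split_ifs <;> simp [pauliY_conjTranspose, pauliY_mul_self]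

end Measure

end SymQKD

theorem mainTheorem1 {a b e f C : Type*}
    [Fintype a] [Fintype b] [Fintype e] [Fintype f] [Fintype C]
    [DecidableEq a] [DecidableEq b] [DecidableEq e] [DecidableEq f]
    (N : ℕ)
    (UA : Matrix a a ℂ) (hUA : UA * UA = 1) (hUA' : UAᴴ * UA = 1)
    (UB : Matrix b b ℂ) (hUB : UB * UB = 1) (hUB' : UBᴴ * UB = 1)
    (σ : Fin N → Matrix (a × b) (a × b) ℂ) (hσ : ∀ m, SymQKD.IsParityMixture UA UB (σ m))
    (ρE : Matrix e e ℂ) (hρE : SymQKD.IsState ρE)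
    (ρABE : Matrix ((Fin N → a × b) × e) ((Fin N → a × b) × e) ℂ)
    (hdecoupled : ρABE = SymQKD.tensorRounds σ ⊗ₖ ρE)
    (eve : SymQKD.Instrument ((Fin N → a × b) × e) f (Fin N → C))
    (flip keep : (Fin N → C) → Fin N → Bool) (c : Fin N → C)
    (hc : eve.prob (SymQKD.preparedState UA UB ρABE) c ≠ 0) :
    (SymQKD.IsPerfectlyPrivate (SymQKD.protocolI UA UB ρABE eve flip keep c) ∧
      SymQKD.IsSecret 0 (SymQKD.protocolI UA UB ρABE eve flip keep c)) ∧
    (SymQKD.IsPerfectlyPrivate (SymQKD.protocolIa UA UB ρABE eve flip keep c) ∧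
      SymQKD.IsSecret 0 (SymQKD.protocolIa UA UB ρABE eve flip keep c)) := by
  subst hdecoupled
  have hρ : (SymQKD.tensorRounds σ ⊗ₖ ρE).PosSemidef :=
    (SymQKD.tensorRounds_posSemidef fun m => (hσ m).conj_eq.1).kronecker hρE.1
  -- The nonzero probability of `c` is needed only for normalization; the symmetry below holds
  -- without it.
  have hstate : SymQKD.IsState
      (SymQKD.siftedState UA UB (SymQKD.tensorRounds σ ⊗ₖ ρE) eve flip keep c) :=
    ((SymQKD.instrument_condState_isState eve
      (SymQKD.preparedState_posSemidef UA UB hρ) hc).bobCorrect _).sift _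
  have hsym : SymQKD.IsSymmetric (SymQKD.pauliY ⊗ₖ SymQKD.pauliY)
      (SymQKD.siftedState UA UB (SymQKD.tensorRounds σ ⊗ₖ ρE) eve flip keep c) :=
    (((SymQKD.preparedState_isSymmetric hUA hUB (fun m => (hσ m).conj_eq.2)
      ρE).instrument_condState eve c).bobCorrect _).sift _
  have hI := hsym.keyI_isPerfectlyPrivate hstate
  have hIa := hsym.keyIa_isPerfectlyPrivate hstate
  exact ⟨⟨hI, hI.isSecret⟩, ⟨hIa, hIa.isSecret⟩⟩
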